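/- **Theorem.** Let $n\ge 2$, let $\mathbb Z^n$ be the nearest-neighbour integer lattice, let $q\in[1,\infty]$ and $d(x,y)=\|x-y\|_q$. Let $(U_v)_{v\in\mathbb Z^n}$ be independent Uniform$(0,1)$ random variables and, for $\theta\in[0,1]$, label each vertex $v$ by $X_v=U_v+\theta\, d(0,v)$. Fix a class of permitted infinite simple nearest-neighbour paths $x_0=0,x_1,x_2,\dots$ in $\mathbb Z^n$, namely either * (non-backtracking) those in which every step moves further from the origin, i.e. $d(0,x_{j+1})>d(0,x_j)$ for all $j$ when $q<\infty$, and $\|x_{j+1}\|_1>\|x_j\|_1$ for all $j$ when $q=\infty$ (for $q<\infty$ this second condition, in terms of the graph distance, is equivalent to the first), or * all such simple paths. Accessibility percolation occurs if there is a permitted path with $X_{x_0}<X_{x_1}<X_{x_2}<\cdots$. Let $$\theta_c=\inf\{\theta\in[0,1]:\ \mathbb P(\text{accessibility percolation occurs with parameter }\theta)>0\}.$$ Then, for each of the two classes of paths, $\theta_c\in(0,1)$. -/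

import Mathlib

open MeasureTheory Set
open scoped ENNReal

noncomputable section

namespace RMF

/-- The vertex set of the integer lattice `ℤⁿ`. -/
abbrev Site (n : ℕ) : Type := Fin n → ℤ

/-- The nearest-neighbour graph on `ℤⁿ`: two sites are adjacent when they differ by exactly one
in exactly one coordinate. -/
def latticeGraph (n : ℕ) : SimpleGraph (Site n) where
  Adj x y := ∑ i, |x i - y i| = 1
  symm := ⟨fun x y h => by simpa only [abs_sub_comm] using h⟩
  loopless := ⟨fun x h => by simp at h⟩

/-- The `ℓ^q` distance on `ℤⁿ` (for `q = ∞` the maximum distance); for `q = 1` it is the graph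
distance of the lattice. -/
def lqDist {n : ℕ} (q : ℝ≥0∞) (x y : Site n) : ℝ :=
  dist (WithLp.toLp q (fun i => (x i : ℝ))) (WithLp.toLp q (fun i => (y i : ℝ)))

/-- Infinite simple nearest-neighbour paths in `ℤⁿ` started from the origin. -/
structure IsInfinitePath {n : ℕ} (x : ℕ → Site n) : Prop where
  start : x 0 = 0
  adj : ∀ j, (latticeGraph n).Adj (x j) (x (j + 1))
  simple : Function.Injective x

/-- Every step of the path strictly increases the `ℓ^r` distance to the origin. -/
def MovesAway {n : ℕ} (r : ℝ≥0∞) (x : ℕ → Site n) : Prop :=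
  ∀ j, lqDist r 0 (x j) < lqDist r 0 (x (j + 1))

/-- The Rough Mount Fuji label `X_v = U_v + θ d(0, v)`, with `d` the `ℓ^q` distance. -/
def label {n : ℕ} (q : ℝ≥0∞) (θ : ℝ) (U : Site n → ℝ) (v : Site n) : ℝ :=
  U v + θ * lqDist q 0 v

/-- Accessibility percolation: some infinite path from the origin in the class `allowed` has
strictly increasing labels. -/
def Percolates {n : ℕ} (q : ℝ≥0∞) (allowed : (ℕ → Site n) → Prop) (θ : ℝ)
    (U : Site n → ℝ) : Prop :=
  ∃ x : ℕ → Site n, IsInfinitePath x ∧ allowed x ∧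
    ∀ j, label q θ U (x j) < label q θ U (x (j + 1))

/-- The uniform distribution on `(0, 1)`. -/
def uniform01 : Measure ℝ := volume.restrict (Ioo 0 1)

instance : IsProbabilityMeasure uniform01 := ⟨by simp [uniform01]⟩

/-- The joint law of independent Uniform(0,1) variables `U_v`, `v ∈ ℤⁿ`. -/
def noise (n : ℕ) : Measure (Site n → ℝ) := Measure.infinitePi fun _ => uniform01

/-- The threshold `θ_c = inf {θ ∈ [0,1] : P_θ(accessibility percolation) > 0}` for the `ℓ^q`
distance and the class `allowed` of permitted paths. -/
def thetaC {n : ℕ} (q : ℝ≥0∞) (allowed : (ℕ → Site n) → Prop) : ℝ :=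
  sInf {θ : ℝ | θ ∈ Icc 0 1 ∧ 0 < noise n {U | Percolates q allowed θ U}}

end RMF

end

/-! The threshold is positive by a first moment bound. A step raises the distance by at most 1, so
along an accessible path the noise always satisfies `U (x (j+1)) > U (x j) - θ`. For a fixed simple
path of `L` steps this has probability at most `ρ ^ (L + 1) * exp l` with `ρ = exp (l * θ) / l`, for
every `l > 0` (`noise_chain_le`). If `θ` is small, some `l` makes `ρ` at most half the inverse of
the number of available steps, and a union bound over words shows that percolation has probability
zero (`noise_percolates_eq_zero`).

The threshold is below 1 because of a path of right and up steps in a coordinate plane. The plane is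
divided into cells, `K` sites wide and two rows high. A good cell has all its noise in `(δ, 1 - δ)`,
`δ = η / K`, and a column in which the noise passes from below to above `1/2`. Such a column allows
a step up for any `θ ≥ 0`. A step right inside good cells needs only `θ` times the distance gained
to be at least `1 - 2 * δ`.

Bad cells are rare, so a Peierls count gives with probability at least `1/2` an increasing Lipschitz
surface `F` of good cells (`exists_surface`, `measure_blocked_le`). Since `F` has slope at most one
in cells of width `K`, the path stays in the cone `K * b ≤ a`. There a right step gains at least `1
- ε` with `ε = K ^ (-q)` for `1 < q < ∞`, and `ε = 0` for `q = 1, ∞` (`exists_increment_bound`). As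
`ε` is smaller than `δ` for large `K`, the value `θ = (1 - 2 * δ) / (1 - ε)`, or 0 if this is
negative, lies below 1 and suffices. -/

namespace RMF

/-! ### Product measures and union bounds -/

/-- The restrictions of a product measure to disjoint blocks of coordinates, all of the same shape,
are independent and identically distributed. -/
theorem infinitePi_forall_block {V T κ : Type*} [Fintype T] (μ : Measure ℝ)
    [IsProbabilityMeasure μ] (g : T → κ → V) (hg : Function.Injective (fun p : T × κ => g p.1 p.2))
    {A : Set (κ → ℝ)} (hA : MeasurableSet A) :
    Measure.infinitePi (fun _ : V => μ) {U | ∀ t, (fun k => U (g t k)) ∈ A} =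
      Measure.infinitePi (fun _ : κ => μ) A ^ Fintype.card T := by
  have h1 := Measure.map_infinitePi_infinitePi_of_inj (P := fun _ : V => μ) hg
  have h2 := Measure.infinitePi_map_curry (fun (_ : T) (_ : κ) => μ)
  have hm : MeasurableSet ((univ : Set T).pi fun _ => A) :=
    MeasurableSet.pi (to_countable _) (fun _ _ => hA)
  have h3 : Measure.infinitePi (fun _ : T => Measure.infinitePi fun _ : κ => μ)
      ((univ : Set T).pi fun _ => A) =
      Measure.infinitePi (fun _ : κ => μ) A ^ Fintype.card T := by
    rw [Measure.infinitePi_pi_univ _ (fun _ => hA)]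
    simp
  rw [← h3, ← h2, ← h1, Measure.map_apply (MeasurableEquiv.measurable _) hm,
    Measure.map_apply (by fun_prop) (MeasurableEquiv.measurable _ hm)]
  congr 1
  ext U
  simp only [mem_ofPred_eq, mem_preimage, mem_univ_pi]
  rfl

theorem noise_eval (n : ℕ) (v : Site n) {A : Set ℝ} (hA : MeasurableSet A) :
    noise n {U | U v ∈ A} = uniform01 A := by
  have h := Measure.infinitePi_map_eval (fun _ : Site n => uniform01) v
  conv_rhs => rw [← h]
  rw [Measure.map_apply (by fun_prop) hA]
  rfl

instance (n : ℕ) : IsProbabilityMeasure (noise n) := by unfold noise; infer_instance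

/-- The walk from `v` that follows the letters of the word `w`. -/
def walk {V E : Type*} (step : V → E → V) (v : V) (w : ℕ → E) : ℕ → V
  | 0 => v
  | k + 1 => step (walk step v w k) (w k)

theorem walk_congr {V E : Type*} (step : V → E → V) (v : V) {w w' : ℕ → E} {L : ℕ}
    (h : ∀ k < L, w k = w' k) : ∀ k ≤ L, walk step v w k = walk step v w' k
  | 0, _ => rfl
  | k + 1, hk => by simp only [walk]; rw [walk_congr step v h k (by omega), h k (by omega)]

/-- Union bound over the words of length `L`. -/
theorem measure_exists_word_le {Ω E : Type*} [MeasurableSpace Ω] (μ : Measure Ω) [Fintype E]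
    [Nonempty E] (L : ℕ) (P : (ℕ → E) → Set Ω) (c : ℝ≥0∞)
    (hP : ∀ w w' : ℕ → E, (∀ k < L, w k = w' k) → P w ⊆ P w') (hc : ∀ w, μ (P w) ≤ c) :
    μ (⋃ w, P w) ≤ (Fintype.card E : ℝ≥0∞) ^ L * c := by
  classical
  let ext : (Fin L → E) → ℕ → E := fun w k =>
    if h : k < L then w ⟨k, h⟩ else Classical.arbitrary E
  calc μ (⋃ w, P w) ≤ μ (⋃ w : Fin L → E, P (ext w)) := by
        refine measure_mono (iUnion_subset fun w => ?_)
        refine (hP w (ext fun k => w k) fun k hk => ?_).trans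
          (subset_iUnion (fun w : Fin L → E => P (ext w)) (fun k => w k))
        simp [ext, hk]
    _ ≤ ∑ w : Fin L → E, μ (P (ext w)) := measure_iUnion_fintype_le _ _
    _ ≤ ∑ w : Fin L → E, c := Finset.sum_le_sum fun w _ => hc _
    _ = _ := by simp

/-! ### Almost increasing chains of uniform variables -/

/-- The points of `ℝ^L` which form, together with the initial value `t`, a chain each of whose
steps goes down by less than `θ`. -/
def chainSet (θ : ℝ) (L : ℕ) (t : ℝ) : Set (Fin L → ℝ) :=
  {u | ∀ j : Fin L, (Fin.cons t u : Fin (L + 1) → ℝ) j.castSucc - θ < u j}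

theorem mem_chainSet_succ {θ : ℝ} {L : ℕ} {t : ℝ} {u : Fin (L + 1) → ℝ} :
    u ∈ chainSet θ (L + 1) t ↔ t - θ < u 0 ∧ (fun j => u (Fin.succ j)) ∈ chainSet θ L (u 0) := by
  simp only [chainSet, mem_ofPred_eq, Fin.forall_fin_succ (n := L)]
  refine and_congr (by simp) (forall_congr' fun j => ?_)
  have : (Fin.cons (u 0) (fun j => u (Fin.succ j)) : Fin (L + 1) → ℝ) = u := by
    ext i; refine Fin.cases rfl (fun i => rfl) i
  rw [this, ← Fin.succ_castSucc, Fin.cons_succ]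

theorem measurableSet_chainSet (θ : ℝ) (L : ℕ) :
    MeasurableSet {p : ℝ × (Fin L → ℝ) | p.2 ∈ chainSet θ L p.1} := by
  have : {p : ℝ × (Fin L → ℝ) | p.2 ∈ chainSet θ L p.1} = ⋂ j : Fin L, {p : ℝ × (Fin L → ℝ) |
      (Fin.cons p.1 p.2 : Fin (L + 1) → ℝ) j.castSucc - θ < p.2 j} := by
    ext p; simp [chainSet]
  rw [this]
  refine MeasurableSet.iInter fun j => measurableSet_lt ?_ (by fun_prop)
  refine Measurable.sub_const ?_ _
  rcases j with ⟨j, hj⟩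
  cases j with
  | zero => exact measurable_fst
  | succ j =>
    have : (fun p : ℝ × (Fin L → ℝ) => (Fin.cons p.1 p.2 : Fin (L + 1) → ℝ)
        (Fin.castSucc ⟨j + 1, hj⟩)) = fun p => p.2 ⟨j, by omega⟩ := by
      ext p; rfl
    rw [this]; fun_prop

/-- Conditioning on the first entry integrates the bound over `s > t - θ`. Dropping the constraint
`s < 1`, the exponential reproduces itself: the integral of `exp (l * (1 - s))` over `s > t - θ` is
`exp (l * θ) / l` times `exp (l * (1 - t))`. -/
theorem pi_chainSet_le {θ l : ℝ} (hl : 0 < l) (L : ℕ) (t : ℝ) (ht : t ≤ 1) :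
    Measure.pi (fun _ : Fin L => uniform01) (chainSet θ L t) ≤
      ENNReal.ofReal ((Real.exp (l * θ) / l) ^ L * Real.exp (l * (1 - t))) := by
  induction L generalizing t with
  | zero =>
    refine prob_le_one.trans ?_
    rw [ENNReal.one_le_ofReal]
    simp only [pow_zero, one_mul, Real.one_le_exp_iff]
    exact mul_nonneg hl.le (by linarith)
  | succ L ih =>
    set ρ := Real.exp (l * θ) / l with hρ
    have hρ0 : 0 < ρ := by positivity
    have hmp := measurePreserving_piFinSuccAbove (fun _ : Fin (L + 1) => uniform01) 0
    let S : Set (ℝ × (Fin L → ℝ)) := {p | t - θ < p.1 ∧ p.2 ∈ chainSet θ L p.1}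
    have hS : MeasurableSet S :=
      (measurableSet_lt measurable_const measurable_fst).inter (measurableSet_chainSet θ L)
    have h1 : chainSet θ (L + 1) t =
        (MeasurableEquiv.piFinSuccAbove (fun _ : Fin (L + 1) => ℝ) 0) ⁻¹' S := by
      ext u
      rw [mem_chainSet_succ]
      rfl
    rw [h1, hmp.measure_preimage hS.nullMeasurableSet, Measure.prod_apply hS]
    have hint : IntegrableOn (fun s => ρ ^ L * Real.exp l * Real.exp (-l * s)) (Ioi (t - θ)) :=
      (integrableOn_exp_mul_Ioi (by linarith) _).const_mul _
    calc _ ≤ ∫⁻ s in Ioi (t - θ), ENNReal.ofReal (ρ ^ L * Real.exp l * Real.exp (-l * s)) := by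
          rw [← lintegral_indicator measurableSet_Ioi, uniform01,
            ← lintegral_indicator measurableSet_Ioo]
          refine lintegral_mono fun s => ?_
          by_cases hs : s ∈ Ioo (0 : ℝ) 1
          · rw [indicator_of_mem hs]
            by_cases hts : t - θ < s
            · rw [indicator_of_mem (mem_Ioi.2 hts)]
              refine (measure_mono fun u hu => hu.2).trans ((ih s hs.2.le).trans_eq ?_)
              rw [mul_assoc, ← Real.exp_add]
              ring_nf
            · have : Prod.mk s ⁻¹' S = ∅ := by ext u; simp [S, hts]
              simp [this]
          · simp [indicator_of_notMem hs]
      _ = _ := by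
          rw [← ofReal_integral_eq_lintegral_ofReal hint
            (Filter.Eventually.of_forall fun s => by positivity), integral_const_mul,
            integral_exp_mul_Ioi (by linarith)]
          congr 1
          have : l * (1 - t) + l * θ = l + -l * (t - θ) := by ring
          have h2 : Real.exp (l * (1 - t)) * Real.exp (l * θ) =
              Real.exp l * Real.exp (-l * (t - θ)) := by
            rw [← Real.exp_add, ← Real.exp_add, this]
          rw [pow_succ, neg_div_neg_eq, mul_assoc, mul_assoc, hρ]
          congr 1
          rw [mul_div_assoc', ← h2]
          ring

/-- An almost increasing sequence of labels along a fixed simple path is exponentially unlikely. -/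
theorem noise_chain_le {n : ℕ} {θ l : ℝ} (hθ : 0 ≤ θ) (hl : 0 < l) (L : ℕ)
    {x : ℕ → Site n} (hx : InjOn x (Iic L)) :
    noise n {U | ∀ j < L, U (x j) - θ < U (x (j + 1))} ≤
      ENNReal.ofReal ((Real.exp (l * θ) / l) ^ (L + 1) * Real.exp l) := by
  have hinj : Function.Injective (fun i : Fin (L + 1) => x i) := fun i j h =>
    Fin.ext (hx (mem_Iic.2 (by omega)) (mem_Iic.2 (by omega)) h)
  have h1 := Measure.map_infinitePi_infinitePi_of_inj (P := fun _ : Site n => uniform01) hinj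
  have h0 : noise n {U | U (x 0) ∈ Iic (0 : ℝ)} = 0 := by
    rw [noise_eval _ _ measurableSet_Iic, uniform01, Measure.restrict_apply measurableSet_Iic]
    convert! measure_empty (μ := (volume : Measure ℝ))
    ext s; simp only [mem_inter_iff, mem_Iic, mem_Ioo, mem_empty_iff_false, iff_false]
    intro h; linarith [h.1, h.2.1]
  have hm : MeasurableSet (chainSet θ (L + 1) 0) :=
    (measurableSet_chainSet θ (L + 1)).preimage (f := fun u : Fin (L + 1) → ℝ => ((0 : ℝ), u))
      (by fun_prop)
  -- The `L + 1` values are viewed as a chain started from the fictitious value 0, whose first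
  -- constraint holds because `U (x 0) > 0` almost surely.
  calc _ ≤ noise n ({U | U (x 0) ∈ Iic (0 : ℝ)} ∪
        (fun U (i : Fin (L + 1)) => U (x i)) ⁻¹' chainSet θ (L + 1) 0) := by
        refine measure_mono fun U hU => ?_
        by_cases h : U (x 0) ≤ 0
        · exact Or.inl h
        · refine Or.inr ?_
          rw [mem_preimage, mem_chainSet_succ]
          refine ⟨by push Not at h; simp only [Fin.val_zero]; linarith, fun j => ?_⟩
          have := hU j j.2
          have h2 : (Fin.cons (U (x 0)) (fun j : Fin L => U (x (j.succ : Fin (L + 1)))) :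
              Fin (L + 1) → ℝ) = fun i : Fin (L + 1) => U (x i) := by
            ext i; refine Fin.cases rfl (fun i => rfl) i
          simp only [Fin.val_zero]
          rw [h2]
          simpa using this
    _ ≤ 0 + noise n ((fun U (i : Fin (L + 1)) => U (x i)) ⁻¹' chainSet θ (L + 1) 0) := by
        refine (measure_union_le _ _).trans ?_
        rw [h0]
    _ ≤ _ := by
        rw [zero_add, noise, ← Measure.map_apply (by fun_prop) hm, h1, Measure.infinitePi_eq_pi]
        simpa using pi_chainSet_le (θ := θ) hl (L + 1) 0 zero_le_one

/-! ### No percolation for small `θ` -/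

/-- The difference is a sum of coordinate vectors, so its `ℓ^q` norm is at most its `ℓ¹` norm, which
is 1. -/
theorem lqDist_le_add_one {n : ℕ} {q : ℝ≥0∞} (hq : 1 ≤ q) {x y : Site n}
    (h : (latticeGraph n).Adj x y) : lqDist q 0 y ≤ lqDist q 0 x + 1 := by
  have : Fact (1 ≤ q) := ⟨hq⟩
  have h1 : lqDist q x y ≤ 1 := by
    have h2 : lqDist q x y = ‖WithLp.toLp q (fun i => (x i : ℝ) - (y i : ℝ))‖ := by
      unfold lqDist
      rw [dist_eq_norm]
      rfl
    have h3 : WithLp.toLp q (fun i => (x i : ℝ) - (y i : ℝ)) =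
        ∑ i, WithLp.toLp q (Pi.single i ((x i : ℝ) - (y i : ℝ))) := by
      rw [← WithLp.toLp_sum, Finset.univ_sum_single (fun i => (x i : ℝ) - (y i : ℝ))]
    have h4 : ∑ i, |(x i : ℝ) - (y i : ℝ)| = 1 := by
      have : ∑ i, |x i - y i| = 1 := h
      exact_mod_cast this
    rw [h2, h3]
    refine (norm_sum_le _ _).trans (h4 ▸ Finset.sum_le_sum fun i _ => ?_)
    simp [← Real.norm_eq_abs]
  have h2 : lqDist q 0 y ≤ lqDist q 0 x + lqDist q x y := by
    unfold lqDist
    exact dist_triangle _ _ _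
  linarith

/-- The displacement of a site by a vector of signs. -/
def signStep {n : ℕ} (v : Site n) (e : Fin n → SignType) : Site n := fun i => v i + (e i : ℤ)

theorem exists_word_of_isInfinitePath {n : ℕ} {x : ℕ → Site n} (hx : IsInfinitePath x) :
    ∃ w : ℕ → Fin n → SignType, walk signStep 0 w = x := by
  refine ⟨fun k i => SignType.sign (x (k + 1) i - x k i), ?_⟩
  funext k
  induction k with
  | zero => exact hx.start.symm
  | succ k ih =>
    rw [walk, ih]
    funext i
    have h : ∑ i, |x k i - x (k + 1) i| = 1 := hx.adj k
    have h1 : |x k i - x (k + 1) i| ≤ 1 := by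
      rw [← h]
      exact Finset.single_le_sum (f := fun i => |x k i - x (k + 1) i|)
        (fun i _ => abs_nonneg _) (Finset.mem_univ i)
    rw [abs_le] at h1
    have h2 : x (k + 1) i - x k i = -1 ∨ x (k + 1) i - x k i = 0 ∨ x (k + 1) i - x k i = 1 := by
      omega
    unfold signStep
    rcases h2 with h2 | h2 | h2 <;> simp [h2] <;> omega

theorem noise_percolates_eq_zero {n : ℕ} {q : ℝ≥0∞} (hq : 1 ≤ q)
    (allowed : (ℕ → Site n) → Prop) {θ : ℝ} (h0 : 0 ≤ θ)
    (h1 : θ ≤ 1 / (2 * Real.exp 1 * Fintype.card (Fin n → SignType))) :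
    noise n {U | Percolates q allowed θ U} = 0 := by
  set C := Fintype.card (Fin n → SignType) with hC
  have hC0 : 0 < C := Fintype.card_pos
  have hC0' : (0 : ℝ) < C := by exact_mod_cast hC0
  -- With this `l` one has `l * θ ≤ 1`, hence `C * ρ ≤ C * exp 1 / l = 1 / 2`.
  set l : ℝ := 2 * Real.exp 1 * C with hl
  have hl0 : 0 < l := by positivity
  set ρ := Real.exp (l * θ) / l with hρ
  have hρ0 : 0 < ρ := by positivity
  have hρ1 : C * ρ ≤ 1 / 2 := by
    have h2 : l * θ ≤ 1 := by
      rw [le_div_iff₀ hl0] at h1; linarith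
    have h3 : Real.exp (l * θ) ≤ Real.exp 1 := Real.exp_le_exp.2 h2
    have h4 : ρ ≤ Real.exp 1 / l := by rw [hρ]; gcongr
    calc C * ρ ≤ C * (Real.exp 1 / l) := by gcongr
      _ = 1 / 2 := by rw [hl]; field_simp
  have key : ∀ L : ℕ, noise n {U | Percolates q allowed θ U} ≤
      ENNReal.ofReal ((1 / 2) ^ L * (ρ * Real.exp l)) := fun L => by
    calc _ ≤ noise n (⋃ w : ℕ → Fin n → SignType, {U | InjOn (walk signStep 0 w) (Iic L) ∧
          ∀ j < L, U (walk signStep 0 w j) - θ < U (walk signStep 0 w (j + 1))}) := by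
          refine measure_mono fun U hU => ?_
          obtain ⟨x, hx, -, hU⟩ := hU
          obtain ⟨w, rfl⟩ := exists_word_of_isInfinitePath hx
          refine mem_iUnion.2 ⟨w, hx.simple.injOn, fun j _ => ?_⟩
          have h2 := hU j
          have h3 := lqDist_le_add_one hq (hx.adj j)
          have h4 := mul_le_mul_of_nonneg_left h3 h0
          unfold label at h2
          linarith
      _ ≤ (C : ℝ≥0∞) ^ L * ENNReal.ofReal (ρ ^ (L + 1) * Real.exp l) := by
          refine measure_exists_word_le _ L _ _ (fun w w' hw U hU => ?_) fun w => ?_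
          · have h2 := walk_congr signStep (0 : Site n) hw
            refine ⟨hU.1.congr fun k hk => h2 k hk, fun j hj => ?_⟩
            rw [← h2 j hj.le, ← h2 (j + 1) hj]
            exact hU.2 j hj
          · by_cases hw : InjOn (walk signStep (0 : Site n) w) (Iic L)
            · exact (measure_mono fun U hU => hU.2).trans (noise_chain_le h0 hl0 L hw)
            · simp [hw]
      _ ≤ _ := by
          rw [← ENNReal.ofReal_natCast, ← ENNReal.ofReal_pow hC0'.le,
            ← ENNReal.ofReal_mul (by positivity)]
          refine ENNReal.ofReal_le_ofReal ?_
          calc (C : ℝ) ^ L * (ρ ^ (L + 1) * Real.exp l) = (C * ρ) ^ L * (ρ * Real.exp l) := by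
                rw [mul_pow]; ring
            _ ≤ _ := by gcongr
  have hlim : Filter.Tendsto (fun L : ℕ => ENNReal.ofReal ((1 / 2) ^ L * (ρ * Real.exp l)))
      Filter.atTop (nhds 0) := by
    rw [← ENNReal.ofReal_zero]
    refine ENNReal.tendsto_ofReal ?_
    have := (tendsto_pow_atTop_nhds_zero_of_lt_one (r := (1 / 2 : ℝ)) (by norm_num)
      (by norm_num)).mul_const (ρ * Real.exp l)
    simpa using this
  exact le_antisymm (ge_of_tendsto' hlim key) zero_le

/-- The threshold is non-trivial as soon as percolation occurs for some `θ < 1`. -/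
theorem thetaC_mem_Ioo {n : ℕ} {q : ℝ≥0∞} (hq : 1 ≤ q) {allowed : (ℕ → Site n) → Prop} {θ : ℝ}
    (h0 : 0 ≤ θ) (h1 : θ < 1) (h : 0 < noise n {U | Percolates q allowed θ U}) :
    thetaC q allowed ∈ Ioo (0 : ℝ) 1 := by
  have hmem : θ ∈ {θ : ℝ | θ ∈ Icc 0 1 ∧ 0 < noise n {U | Percolates q allowed θ U}} :=
    ⟨⟨h0, h1.le⟩, h⟩
  refine ⟨lt_of_lt_of_le
    (b := 1 / (2 * Real.exp 1 * Fintype.card (Fin n → SignType))) ?_ (le_csInf ⟨θ, hmem⟩ fun t ht => ?_),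
    (csInf_le ⟨0, fun t ht => ht.1.1⟩ hmem).trans_lt h1⟩
  · have : 0 < Fintype.card (Fin n → SignType) := Fintype.card_pos
    positivity
  · by_contra hlt
    exact ht.2.ne' (noise_percolates_eq_zero hq allowed ht.1.1 (not_le.1 hlt).le)

/-! ### Lipschitz surfaces above blocked cells -/

/-- `Blocked B i h` says that the increasing `1`-Lipschitz function which avoids the bad cells must
be at least `h` at `i`. -/
inductive Blocked (B : ℕ → ℕ → Prop) : ℕ → ℕ → Prop
  | base (i : ℕ) : Blocked B i 0
  | right {i h : ℕ} : Blocked B i h → Blocked B (i + 1) h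
  | left {i h : ℕ} : Blocked B (i + 1) (h + 1) → Blocked B i h
  | up {i h : ℕ} : Blocked B i h → B i h → Blocked B i (h + 1)

theorem Blocked.pred {B : ℕ → ℕ → Prop} {i h : ℕ} (H : Blocked B i (h + 1)) : Blocked B i h :=
  H.right.left

theorem Blocked.mono {B : ℕ → ℕ → Prop} {i h h' : ℕ} (hh : h ≤ h') (H : Blocked B i h') :
    Blocked B i h := by
  induction hh with
  | refl => exact H
  | step _ ih => exact ih H.pred

/-- If the height `1` is not blocked at `1`, there is an increasing `1`-Lipschitz function avoiding
the bad cells. -/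
theorem exists_surface {B : ℕ → ℕ → Prop} (h : ¬ Blocked B 1 1) :
    ∃ F : ℕ → ℕ, F 0 = 0 ∧ F 1 = 0 ∧ (∀ i, ¬ B i (F i)) ∧
      ∀ i, F i ≤ F (i + 1) ∧ F (i + 1) ≤ F i + 1 := by
  classical
  have h0 : ¬ Blocked B 0 1 := fun H => h H.right
  -- The rule `left` moves down the diagonal to `(1, 1)`, so blocked heights are bounded in each
  -- column and a largest one exists. That height is `F i`, and the rule `up` forbids a bad cell
  -- there.
  have hsucc : ∀ i, ¬ Blocked B (i + 1) (i + 1) := by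
    intro i
    induction i with
    | zero => exact h
    | succ i ih => exact fun H => ih H.left
  have hex : ∀ i, ∃ k, ¬ Blocked B i (k + 1) := by
    rintro (_ | i)
    · exact ⟨0, h0⟩
    · exact ⟨i, hsucc i⟩
  have hmin : ∀ i, Blocked B i (Nat.find (hex i)) := by
    intro i
    rcases hk : Nat.find (hex i) with _ | k
    · exact .base i
    · by_contra H
      have := Nat.find_min' (hex i) H
      omega
  refine ⟨fun i => Nat.find (hex i), ?_, ?_, fun i H => ?_, fun i => ⟨?_, ?_⟩⟩
  · exact (Nat.find_eq_zero _).2 h0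
  · exact (Nat.find_eq_zero _).2 h
  · exact Nat.find_spec (hex i) ((hmin i).up H)
  · by_contra hlt
    push Not at hlt
    exact Nat.find_spec (hex (i + 1)) ((hmin i).right.mono hlt)
  · by_contra hlt
    push Not at hlt
    exact Nat.find_spec (hex i) (((hmin (i + 1)).mono hlt).left)

/-- The backward moves: letter `0` undoes a step to the right, letter `1` undoes a step down to the
left, and letter `2` undoes a step up. -/
def backStep (v : ℤ × ℤ) (e : Fin 3) : ℤ × ℤ :=
  if e = 0 then (v.1 - 1, v.2) else if e = 1 then (v.1 + 1, v.2 + 1) else (v.1, v.2 - 1)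

/-- The word `w` traces back in `L` steps a simple path from `(1, 1)` to height zero, along which
all steps up cross bad cells. -/
structure IsBlockingWord (B : ℕ → ℕ → Prop) (L : ℕ) (w : ℕ → Fin 3) : Prop where
  inj : InjOn (walk backStep (1, 1) w) (Iic L)
  nonneg : ∀ k ≤ L, 0 ≤ (walk backStep (1, 1) w k).1 ∧ 0 ≤ (walk backStep (1, 1) w k).2
  height : (walk backStep (1, 1) w L).2 = 0
  bad : ∀ k < L, w k = 2 → B (walk backStep (1, 1) w (k + 1)).1.toNat
    (walk backStep (1, 1) w (k + 1)).2.toNat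

/-- A backward step of the blocking dynamics. -/
def BackRel (B : ℕ → ℕ → Prop) (v v' : ℤ × ℤ) (e : Fin 3) : Prop :=
  v' = backStep v e ∧ 0 ≤ v.1 ∧ 0 ≤ v.2 ∧ 0 ≤ v'.1 ∧ 0 ≤ v'.2 ∧
    (e = 2 → B v'.1.toNat v'.2.toNat)

/-- A derivation of `Blocked` read from its conclusion back to `base` is such a path. -/
theorem Blocked.exists_path {B : ℕ → ℕ → Prop} {i h : ℕ} (H : Blocked B i h) :
    ∃ (L : ℕ) (p : ℕ → ℤ × ℤ), p 0 = ((i : ℤ), (h : ℤ)) ∧ (p L).2 = 0 ∧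
      ∀ k < L, ∃ e, BackRel B (p k) (p (k + 1)) e := by
  have cons : ∀ {v v' : ℤ × ℤ} {e : Fin 3}, BackRel B v v' e →
      (∃ (L : ℕ) (p : ℕ → ℤ × ℤ), p 0 = v' ∧ (p L).2 = 0 ∧
        ∀ k < L, ∃ e, BackRel B (p k) (p (k + 1)) e) →
      ∃ (L : ℕ) (p : ℕ → ℤ × ℤ), p 0 = v ∧ (p L).2 = 0 ∧
        ∀ k < L, ∃ e, BackRel B (p k) (p (k + 1)) e := by
    rintro v v' e hr ⟨L, p, hp0, hpL, hp⟩
    refine ⟨L + 1, fun k => Nat.casesOn k v p, rfl, hpL, fun k hk => ?_⟩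
    cases k with
    | zero => exact ⟨e, by simpa [hp0] using hr⟩
    | succ k => exact hp k (by omega)
  induction H with
  | base i => exact ⟨0, fun _ => (i, 0), by simp, by simp, by simp⟩
  | @right i h _ ih =>
    exact cons (e := 0) (by simp [BackRel, backStep]; omega) ih
  | @left i h _ ih =>
    exact cons (e := 1) (by simp [BackRel, backStep]; omega) ih
  | @up i h _ hB ih =>
    refine cons (e := 2) ?_ ih
    simp [BackRel, backStep, hB]
    omega

theorem Blocked.exists_isBlockingWord {B : ℕ → ℕ → Prop} (H : Blocked B 1 1) :
    ∃ L w, IsBlockingWord B (L + 1) w := by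
  classical
  have hex := H.exists_path
  obtain ⟨p, hp0, hpL, hp⟩ := Nat.find_spec hex
  set L := Nat.find hex with hL
  have hinj : InjOn p (Iic L) := by
    have key : ∀ a b, a < b → b ≤ L → p a ≠ p b := by
      intro a b hab hb heq
      -- A path of minimal length is simple: a loop between times `a` and `b` could be cut out.
      refine Nat.find_min hex (m := L - (b - a)) (by omega)
        ⟨fun k => if k ≤ a then p k else p (k + (b - a)), by simpa using hp0, ?_, fun k hk => ?_⟩
      · by_cases h : L - (b - a) ≤ a
        · have hbL : b = L := by omega
          have : L - (b - a) = a := by omega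
          change (if L - (b - a) ≤ a then p (L - (b - a)) else _).2 = 0
          rw [if_pos h, this, heq, hbL, hpL]
        · simp only [h, if_false]
          rw [Nat.sub_add_cancel (by omega), hpL]
      · rcases lt_trichotomy k a with h | h | h
        · simp only [h.le, if_true, Nat.succ_le_of_lt h]
          exact hp k (by omega)
        · subst h
          have : ¬ k + 1 ≤ k := by omega
          simp only [le_refl, if_true, this, if_false, heq]
          rw [show k + 1 + (b - k) = b + 1 by omega]
          exact hp b (by omega)
        · have h1 : ¬ k ≤ a := by omega
          have h2 : ¬ k + 1 ≤ a := by omega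
          simp only [h1, h2, if_false]
          rw [show k + 1 + (b - a) = k + (b - a) + 1 by omega]
          exact hp _ (by omega)
    intro a ha b hb hab
    rcases lt_trichotomy a b with h | h | h
    · exact absurd hab (key a b h hb)
    · exact h
    · exact absurd hab.symm (key b a h ha)
  have hLpos : L ≠ 0 := fun h => by rw [h, hp0] at hpL; simp at hpL
  choose! w hw using hp
  have hwalk : ∀ k ≤ L, walk backStep (1, 1) w k = p k := by
    intro k
    induction k with
    | zero => intro _; rw [hp0]; rfl
    | succ k ih =>
      intro hk
      rw [walk, ih (by omega), (hw k (by omega)).1]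
  obtain ⟨M, hM⟩ := Nat.exists_eq_succ_of_ne_zero hLpos
  refine ⟨M, w, ?_⟩
  rw [← Nat.succ_eq_add_one, ← hM]
  refine ⟨?_, fun k hk => ?_, by rw [hwalk L le_rfl, hpL], fun k hk h2 => ?_⟩
  · exact hinj.congr fun k hk => (hwalk k hk).symm
  · rw [hwalk k hk]
    rcases Nat.lt_or_ge k L with h | h
    · exact ⟨(hw k h).2.1, (hw k h).2.2.1⟩
    · obtain rfl : k = L := le_antisymm hk h
      have := (hw M (by omega)).2.2.2
      rw [hM]
      exact ⟨this.1, this.2.1⟩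
  · rw [hwalk (k + 1) hk]
    exact (hw k hk).2.2.2.2.2 h2

/-- The steps of a word up to time `L` which undo a step up. -/
def upTimes (w : ℕ → Fin 3) (L : ℕ) : Finset ℕ := (Finset.range L).filter fun k => w k = 2

theorem walk_backStep_count (w : ℕ → Fin 3) (L : ℕ) :
    ∃ a b : ℕ, a + b + (upTimes w L).card = L ∧
      walk backStep (1, 1) w L = (1 - (a : ℤ) + b, 1 + (b : ℤ) - (upTimes w L).card) := by
  induction L with
  | zero => exact ⟨0, 0, by simp [upTimes], by simp [walk, upTimes]⟩
  | succ L ih =>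
    obtain ⟨a, b, h1, h2⟩ := ih
    have hu : (upTimes w (L + 1)).card = (upTimes w L).card + if w L = 2 then 1 else 0 := by
      unfold upTimes
      rw [Finset.range_add_one, Finset.filter_insert]
      split_ifs
      · rw [Finset.card_insert_of_notMem (by simp)]
      · simp
    rw [hu, walk, h2, backStep]
    have h3 : w L = 0 ∨ w L = 1 ∨ w L = 2 := by
      generalize w L = e
      fin_cases e <;> simp
    rcases h3 with h3 | h3 | h3
    · exact ⟨a + 1, b, by simp [h3]; omega, by simp [h3]; omega⟩
    · exact ⟨a, b + 1, by simp [h3]; omega, by simp [h3]; omega⟩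
    · exact ⟨a, b, by simp [h3]; omega, by simp [h3]; omega⟩

/-- With `a`, `b`, `u` letters of the three kinds, final height 0 gives `u = b + 1`, and a
nonnegative abscissa gives `a ≤ b + 1`; hence `a + b + u ≤ 3 * u`. -/
theorem IsBlockingWord.le_card {B : ℕ → ℕ → Prop} {L : ℕ} {w : ℕ → Fin 3}
    (h : IsBlockingWord B L w) : L ≤ 3 * (upTimes w L).card := by
  obtain ⟨a, b, h1, h2⟩ := walk_backStep_count w L
  have h3 := h.height
  have h4 := h.nonneg L le_rfl
  rw [h2] at h3 h4
  simp only at h3 h4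
  omega

/-- If any finite set of cells is entirely bad with exponentially small probability, then height
`1` is blocked at `1` with probability at most `1/2`. -/
theorem measure_blocked_le {Ω : Type*} [MeasurableSpace Ω] (μ : Measure Ω) [IsProbabilityMeasure μ]
    (B : Ω → ℕ → ℕ → Prop)
    (hB : ∀ T : Finset (ℕ × ℕ), μ {ω | ∀ c ∈ T, B ω c.1 c.2} ≤ ((9 : ℝ≥0∞)⁻¹ ^ 3) ^ T.card) :
    μ {ω | Blocked (B ω) 1 1} ≤ 2⁻¹ := by
  have hL : ∀ L, μ (⋃ w, {ω | IsBlockingWord (B ω) L w}) ≤ 3⁻¹ ^ L := fun L => by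
    calc _ ≤ (Fintype.card (Fin 3) : ℝ≥0∞) ^ L * (9⁻¹) ^ L := by
          refine measure_exists_word_le μ L _ _ (fun w w' hw ω hω => ?_) fun w => ?_
          · have h2 := walk_congr backStep ((1, 1) : ℤ × ℤ) hw
            refine ⟨hω.inj.congr fun k hk => h2 k hk, fun k hk => ?_, ?_, fun k hk h3 => ?_⟩
            · rw [← h2 k hk]; exact hω.nonneg k hk
            · rw [← h2 L le_rfl]; exact hω.height
            · rw [← h2 (k + 1) hk]; exact hω.bad k hk (by rw [hw k hk, h3])
          -- The trace of `w` does not depend on `ω`, so one sample `ω₀` for which `w` is blocking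
          -- already yields distinct cells and the count of upward steps.
          · by_cases hne : ∃ ω, IsBlockingWord (B ω) L w
            swap
            · push Not at hne
              simp [hne]
            obtain ⟨ω₀, h₀⟩ := hne
            let cell : ℕ → ℕ × ℕ := fun k => ((walk backStep (1, 1) w (k + 1)).1.toNat,
              (walk backStep (1, 1) w (k + 1)).2.toNat)
            have hcell : InjOn cell (upTimes w L) := by
              intro k hk k' hk' hkk
              have hk : k < L := by simp [upTimes] at hk; exact hk.1
              have hk' : k' < L := by simp [upTimes] at hk'; exact hk'.1
              have h1 := h₀.nonneg (k + 1) hk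
              have h2 := h₀.nonneg (k' + 1) hk'
              simp only [cell, Prod.mk.injEq] at hkk
              have := h₀.inj (show k + 1 ∈ Iic L from hk) (show k' + 1 ∈ Iic L from hk') (Prod.ext (by omega) (by omega))
              omega
            have hcard : ((upTimes w L).image cell).card = (upTimes w L).card :=
              Finset.card_image_of_injOn hcell
            refine (measure_mono fun ω hω => ?_).trans ((hB ((upTimes w L).image cell)).trans ?_)
            · intro c hc
              obtain ⟨k, hk, rfl⟩ := Finset.mem_image.1 hc
              simp only [upTimes, Finset.mem_filter, Finset.mem_range] at hk
              exact IsBlockingWord.bad hω k hk.1 hk.2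
            · rw [hcard, ← pow_mul]
              exact pow_le_pow_right_of_le_one' (by norm_num) h₀.le_card
      _ = _ := by
          rw [← mul_pow]
          congr 1
          rw [show (9 : ℝ≥0∞) = 3 * 3 by norm_num, ENNReal.mul_inv (by simp) (by simp), ← mul_assoc]
          rw [Fintype.card_fin, Nat.cast_ofNat, ENNReal.mul_inv_cancel (by simp) (by simp), one_mul]
  calc _ ≤ μ (⋃ L, ⋃ w, {ω | IsBlockingWord (B ω) (L + 1) w}) := by
        refine measure_mono fun ω hω => ?_
        obtain ⟨L, w, h⟩ := Blocked.exists_isBlockingWord hω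
        exact mem_iUnion.2 ⟨L, mem_iUnion.2 ⟨w, h⟩⟩
    _ ≤ ∑' L, μ (⋃ w, {ω | IsBlockingWord (B ω) (L + 1) w}) := measure_iUnion_le _
    -- Blocking words are nonempty, as they start at height 1, so the geometric series begins with
    -- exponent 1.
    _ ≤ ∑' L : ℕ, (3 : ℝ≥0∞)⁻¹ ^ (L + 1) := ENNReal.tsum_le_tsum fun L => hL _
    _ = 2⁻¹ := by
        rw [ENNReal.tsum_geometric_add_one]
        have h3 : (3 : ℝ≥0∞)⁻¹ < 1 := by rw [ENNReal.inv_lt_one]; norm_num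
        rw [← ENNReal.toReal_eq_toReal_iff' (ENNReal.mul_ne_top (by norm_num)
          (ENNReal.inv_ne_top.2 (tsub_pos_of_lt h3).ne')) (by norm_num)]
        rw [ENNReal.toReal_mul, ENNReal.toReal_inv, ENNReal.toReal_inv,
          ENNReal.toReal_sub_of_le (by norm_num) (by norm_num)]
        norm_num

/-! ### Good and bad cells -/

/-- A pattern on two rows of length `K` is bad if some entry is within `δ` of `0` or `1`, or if
no column allows for a step up across the level `1/2`. -/
def badPattern (K : ℕ) (δ : ℝ) : Set (Fin K × Bool → ℝ) :=
  {u | ¬ ((∀ k, u k ∈ Ioo δ (1 - δ)) ∧ ∃ c, u (c, false) < 1 / 2 ∧ 1 / 2 < u (c, true))}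

theorem measurableSet_badPattern (K : ℕ) (δ : ℝ) : MeasurableSet (badPattern K δ) := by
  have : badPattern K δ = ((⋂ k, (fun u : Fin K × Bool → ℝ => u k) ⁻¹' Ioo δ (1 - δ)) ∩
      ⋃ c : Fin K, {u | u (c, false) < 1 / 2} ∩ {u | 1 / 2 < u (c, true)})ᶜ := by
    ext u
    simp [badPattern]
  rw [this]
  refine (MeasurableSet.inter (MeasurableSet.iInter fun k => ?_)
    (MeasurableSet.iUnion fun c => MeasurableSet.inter ?_ ?_)).compl
  · exact measurableSet_Ioo.preimage (by fun_prop)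
  · exact measurableSet_lt (by fun_prop) (by fun_prop)
  · exact measurableSet_lt (by fun_prop) (by fun_prop)

theorem uniform01_apply_Ioo {a b : ℝ} (ha : 0 ≤ a) (hb : b ≤ 1) :
    uniform01 (Ioo a b) = ENNReal.ofReal (b - a) := by
  rw [uniform01, Measure.restrict_apply measurableSet_Ioo,
    inter_eq_self_of_subset_left (Ioo_subset_Ioo ha hb), Real.volume_Ioo]

theorem uniform01_compl_Ioo_le {δ : ℝ} (h0 : 0 ≤ δ) :
    uniform01 (Ioo δ (1 - δ))ᶜ ≤ ENNReal.ofReal (2 * δ) := by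
  rw [prob_compl_eq_one_sub measurableSet_Ioo, uniform01_apply_Ioo h0 (by linarith),
    tsub_le_iff_right, ← ENNReal.ofReal_one]
  exact (ENNReal.ofReal_le_ofReal (by linarith)).trans ENNReal.ofReal_add_le

theorem infinitePi_no_step_up_le :
    Measure.infinitePi (fun _ : Bool => uniform01) {u | ¬ (u false < 1 / 2 ∧ 1 / 2 < u true)} ≤
      ENNReal.ofReal (3 / 4) := by
  let t : Bool → Set ℝ := fun b => if b then Ioi (1 / 2) else Iio (1 / 2)
  have ht : ∀ b, MeasurableSet (t b) := by
    rintro (_ | _)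
    · exact measurableSet_Iio
    · exact measurableSet_Ioi
  have h1 : {u : Bool → ℝ | ¬ (u false < 1 / 2 ∧ 1 / 2 < u true)} = (univ.pi t)ᶜ := by
    ext u; simp [t]
  have h2 : uniform01 (t false) = ENNReal.ofReal (1 / 2) := by
    rw [uniform01, Measure.restrict_apply (ht _)]
    have : t false ∩ Ioo 0 1 = Ioo 0 (1 / 2) := by
      ext s; simp only [t, mem_inter_iff, mem_Ioo]
      constructor
      · rintro ⟨h, h', -⟩; exact ⟨h', by simpa using h⟩
      · rintro ⟨h, h'⟩; exact ⟨by simpa using h', h, by linarith⟩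
    rw [this, Real.volume_Ioo, sub_zero]
  have h3 : uniform01 (t true) = ENNReal.ofReal (1 / 2) := by
    rw [uniform01, Measure.restrict_apply (ht _)]
    have : t true ∩ Ioo 0 1 = Ioo (1 / 2) 1 := by
      ext s; simp only [t, mem_inter_iff, mem_Ioo]
      constructor
      · rintro ⟨h, -, h'⟩; exact ⟨by simpa using h, h'⟩
      · rintro ⟨h, h'⟩; exact ⟨by simpa using h, by linarith, h'⟩
    rw [this, Real.volume_Ioo]
    norm_num
  rw [h1, prob_compl_eq_one_sub (MeasurableSet.univ_pi ht), Measure.infinitePi_pi_univ _ ht,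
    tprod_fintype, Fintype.prod_bool, h2, h3, ← ENNReal.ofReal_mul (by norm_num),
    ← ENNReal.ofReal_one, ← ENNReal.ofReal_sub _ (by norm_num)]
  exact ENNReal.ofReal_le_ofReal (by norm_num)

/-- Each of the `2 * K` entries leaves `(δ, 1 - δ)` with probability at most `2 * δ`, and the `K`
columns independently fail to cross `1/2` with probability at most `3/4`. -/
theorem infinitePi_badPattern_le {K : ℕ} {δ : ℝ} (h0 : 0 ≤ δ) :
    Measure.infinitePi (fun _ : Fin K × Bool => uniform01) (badPattern K δ) ≤
      ENNReal.ofReal (4 * (K * δ) + (3 / 4) ^ K) := by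
  set μ := Measure.infinitePi (fun _ : Fin K × Bool => uniform01) with hμ
  have hA : MeasurableSet {u : Bool → ℝ | ¬ (u false < 1 / 2 ∧ 1 / 2 < u true)} :=
    ((measurableSet_Iio.preimage (f := fun u : Bool → ℝ => u false) (by fun_prop)).inter
      (measurableSet_Ioi.preimage (f := fun u : Bool → ℝ => u true) (by fun_prop))).compl
  have h2 := infinitePi_forall_block uniform01 (fun (c : Fin K) (e : Bool) => (c, e))
    (fun p p' h => h) hA
  calc _ ≤ μ ((⋃ k, (fun u => u k) ⁻¹' (Ioo δ (1 - δ))ᶜ) ∪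
        {u | ∀ c, (fun e => u (c, e)) ∈ {u | ¬ (u false < 1 / 2 ∧ 1 / 2 < u true)}}) := by
        refine measure_mono fun u hu => ?_
        rw [badPattern, mem_ofPred_eq, not_and_or] at hu
        rcases hu with hu | hu
        · left
          push Not at hu
          obtain ⟨k, hk⟩ := hu
          exact mem_iUnion.2 ⟨k, hk⟩
        · right
          push Not at hu
          intro c
          simpa using hu c
    _ ≤ ∑ k : Fin K × Bool, μ ((fun u => u k) ⁻¹' (Ioo δ (1 - δ))ᶜ) +
          ENNReal.ofReal (3 / 4) ^ K := by
        refine (measure_union_le _ _).trans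
          (add_le_add (measure_iUnion_fintype_le _ _) (h2.trans_le ?_))
        rw [Fintype.card_fin]
        exact pow_le_pow_left' infinitePi_no_step_up_le _
    _ ≤ ∑ k : Fin K × Bool, ENNReal.ofReal (2 * δ) + ENNReal.ofReal (3 / 4) ^ K := by
        refine add_le_add (Finset.sum_le_sum fun k _ => ?_) le_rfl
        rw [← Measure.map_apply (by fun_prop) measurableSet_Ioo.compl, hμ,
          Measure.infinitePi_map_eval]
        exact uniform01_compl_Ioo_le h0
    _ = _ := by
        rw [Finset.sum_const, nsmul_eq_mul, ← ENNReal.ofReal_natCast, ← ENNReal.ofReal_mul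
          (by positivity), ← ENNReal.ofReal_pow (by norm_num), ← ENNReal.ofReal_add (by positivity)
          (by positivity)]
        simp
        ring_nf

/-- The site of the coordinate plane with coordinates `(a, b)`. -/
def planeSite (n a b : ℕ) : Site n :=
  fun i => if (i : ℕ) = 0 then (a : ℤ) else if (i : ℕ) = 1 then (b : ℤ) else 0

theorem planeSite_inj {n : ℕ} (hn : 2 ≤ n) {a b a' b' : ℕ}
    (h : planeSite n a b = planeSite n a' b') : a = a' ∧ b = b' := by
  have h0 := congrFun h ⟨0, by omega⟩
  have h1 := congrFun h ⟨1, by omega⟩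
  simp [planeSite] at h0 h1
  exact ⟨h0, h1⟩

/-- The site in position `k` of the two-row cell `(i, j)`. -/
def cellSite (n K : ℕ) (c : ℕ × ℕ) (k : Fin K × Bool) : Site n :=
  planeSite n (c.1 * K + k.1) (c.2 + k.2.toNat)

/-- The cell `(i, j)` is bad if the labels in it form a bad pattern. -/
def BadCell (n K : ℕ) (δ : ℝ) (U : Site n → ℝ) (i j : ℕ) : Prop :=
  (fun k => U (cellSite n K (i, j) k)) ∈ badPattern K δ

/-- Vertically adjacent cells share a row; restricting to one parity of the row index makes cells
disjoint. -/
theorem cellSite_inj {n : ℕ} (hn : 2 ≤ n) {K : ℕ} {c c' : ℕ × ℕ} {k k' : Fin K × Bool}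
    (hc : c.2 % 2 = c'.2 % 2) (h : cellSite n K c k = cellSite n K c' k') : c = c' ∧ k = k' := by
  obtain ⟨h1, h2⟩ := planeSite_inj hn h
  have hK : 0 < K := k.1.pos
  have hdiv : ∀ (a : ℕ) (b : Fin K), (a * K + b) / K = a := fun a b => by
    rw [mul_comm, Nat.mul_add_div hK, Nat.div_eq_of_lt b.2, add_zero]
  have h3 : c.1 = c'.1 := by rw [← hdiv c.1 k.1, h1, hdiv]
  rw [h3] at h1
  have h4 : k.1 = k'.1 := Fin.ext (by omega)
  have h5 : k.2.toNat ≤ 1 := Bool.toNat_le _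
  have h6 : k'.2.toNat ≤ 1 := Bool.toNat_le _
  have h7 : k.2.toNat = k'.2.toNat := by omega
  refine ⟨Prod.ext h3 (by omega), Prod.ext h4 ?_⟩
  cases hb : k.2 <;> cases hb' : k'.2 <;> simp [hb, hb'] at h7 ⊢

theorem noise_forall_badCell_of_parity {n : ℕ} (hn : 2 ≤ n) (K : ℕ) (δ : ℝ)
    (T : Finset (ℕ × ℕ)) (r : ℕ) (hT : ∀ c ∈ T, c.2 % 2 = r) :
    noise n {U | ∀ c ∈ T, BadCell n K δ U c.1 c.2} =
      Measure.infinitePi (fun _ : Fin K × Bool => uniform01) (badPattern K δ) ^ T.card := by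
  have h := infinitePi_forall_block uniform01 (fun (c : T) => cellSite n K c) (fun p p' h => ?_)
    (measurableSet_badPattern K δ)
  · rw [Fintype.card_coe] at h
    rw [← h, noise]
    congr 1
    ext U
    simp [BadCell]
  · obtain ⟨h1, h2⟩ := cellSite_inj hn ((hT _ p.1.2).trans (hT _ p'.1.2).symm) h
    exact Prod.ext (Subtype.ext h1) h2

/-- One parity class contains at least half of `T`, and its cells are independent. The factor `r ^
2` for each of them pays for the other half. -/
theorem noise_forall_badCell_le {n : ℕ} (hn : 2 ≤ n) {K : ℕ} {δ : ℝ} {r : ℝ≥0∞} (hr : r ≤ 1)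
    (h : Measure.infinitePi (fun _ : Fin K × Bool => uniform01) (badPattern K δ) ≤ r ^ 2)
    (T : Finset (ℕ × ℕ)) :
    noise n {U | ∀ c ∈ T, BadCell n K δ U c.1 c.2} ≤ r ^ T.card := by
  have key : ∀ s, T.card ≤ 2 * (T.filter fun c => c.2 % 2 = s).card →
      noise n {U | ∀ c ∈ T, BadCell n K δ U c.1 c.2} ≤ r ^ T.card := by
    intro s hs
    calc _ ≤ noise n {U | ∀ c ∈ T.filter fun c => c.2 % 2 = s, BadCell n K δ U c.1 c.2} :=
          measure_mono fun U (hU : ∀ c ∈ T, _) c hc => hU c (Finset.mem_filter.1 hc).1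
      _ ≤ (r ^ 2) ^ (T.filter fun c => c.2 % 2 = s).card := by
          rw [noise_forall_badCell_of_parity hn K δ _ s fun c hc => (Finset.mem_filter.1 hc).2]
          exact pow_le_pow_left' h _
      _ ≤ _ := by
          rw [← pow_mul]
          exact pow_le_pow_right_of_le_one' hr hs
  have hsum := Finset.card_filter_add_card_filter_not (s := T) (fun c : ℕ × ℕ => c.2 % 2 = 0)
  simp only [Nat.mod_two_ne_zero] at hsum
  by_cases h0 : T.card ≤ 2 * (T.filter fun c => c.2 % 2 = 0).card
  · exact key 0 h0
  · exact key 1 (by omega)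

/-- For long cells, with margins of the inverse order of their length, bad cells do not block. -/
theorem exists_noise_blocked_le {n : ℕ} (hn : 2 ≤ n) :
    ∃ η : ℝ, 0 < η ∧ ∃ K₀ : ℕ, ∀ K : ℕ, K₀ ≤ K →
      noise n {U | Blocked (BadCell n K (η / K) U) 1 1} ≤ 2⁻¹ := by
  -- The admissible probability `9⁻¹ ^ 6` is split equally between the margins, `4 * η`, and the
  -- missing columns, `(3 / 4) ^ K`.
  obtain ⟨K₁, hK₁⟩ := exists_pow_lt_of_lt_one (show (0 : ℝ) < (9⁻¹ ^ 3) ^ 2 / 2 by positivity)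
    (show (3 / 4 : ℝ) < 1 by norm_num)
  refine ⟨(9⁻¹ ^ 3) ^ 2 / 8, by positivity, K₁ + 1, fun K hK => measure_blocked_le _ _ fun T => ?_⟩
  refine noise_forall_badCell_le hn (pow_le_one' (by norm_num) _) ?_ T
  refine (infinitePi_badPattern_le (by positivity)).trans ?_
  have hK0 : (K : ℝ) ≠ 0 := by
    have : K ≠ 0 := by omega
    exact_mod_cast this
  have h9 : (9⁻¹ : ℝ≥0∞) = ENNReal.ofReal 9⁻¹ := by
    rw [ENNReal.ofReal_inv_of_pos (by norm_num)]; norm_num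
  rw [h9, ← ENNReal.ofReal_pow (by norm_num), ← ENNReal.ofReal_pow (by norm_num)]
  refine ENNReal.ofReal_le_ofReal ?_
  rw [mul_div_cancel₀ _ hK0]
  have : (3 / 4 : ℝ) ^ K ≤ (3 / 4) ^ K₁ :=
    pow_le_pow_of_le_one (by norm_num) (by norm_num) (by omega)
  linarith

/-! ### Distances in a coordinate plane -/

theorem lqDist_planeSite {n : ℕ} (hn : 2 ≤ n) {q : ℝ≥0∞} (hq : 1 ≤ q) (hq' : q ≠ ∞) (a b : ℕ) :
    lqDist q 0 (planeSite n a b) =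
      ((a : ℝ) ^ q.toReal + (b : ℝ) ^ q.toReal) ^ (1 / q.toReal) := by
  have hp : 0 < q.toReal := ENNReal.toReal_pos (by positivity) hq'
  obtain ⟨m, rfl⟩ := Nat.exists_eq_add_of_le' hn
  unfold lqDist
  rw [PiLp.dist_eq_sum hp, Fin.sum_univ_succ, Fin.sum_univ_succ]
  congr 1
  simp [planeSite, Real.zero_rpow hp.ne']

theorem lqDist_one_planeSite {n : ℕ} (hn : 2 ≤ n) (a b : ℕ) :
    lqDist 1 0 (planeSite n a b) = a + b := by
  rw [lqDist_planeSite hn le_rfl (by simp)]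
  simp

theorem lqDist_top_planeSite {n : ℕ} (hn : 2 ≤ n) (a b : ℕ) :
    lqDist ∞ 0 (planeSite n a b) = max (a : ℝ) b := by
  unfold lqDist
  rw [PiLp.dist_eq_iSup]
  have : Nonempty (Fin n) := ⟨⟨0, by omega⟩⟩
  refine le_antisymm (ciSup_le fun i => ?_) (max_le ?_ ?_)
  · simp only [planeSite, Pi.zero_apply, Int.cast_zero, dist_zero_left]
    split_ifs <;> simp
  · refine le_trans (le_of_eq ?_) (le_ciSup (Finite.bddAbove_range _) ⟨0, by omega⟩)
    simp [planeSite]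
  · refine le_trans (le_of_eq ?_) (le_ciSup (Finite.bddAbove_range _) ⟨1, by omega⟩)
    simp [planeSite]

theorem lqDist_lt_right {n : ℕ} (hn : 2 ≤ n) {q : ℝ≥0∞} (hq : 1 ≤ q) (hq' : q ≠ ∞) (a b : ℕ) :
    lqDist q 0 (planeSite n a b) < lqDist q 0 (planeSite n (a + 1) b) := by
  have hp : 0 < q.toReal := ENNReal.toReal_pos (by positivity) hq'
  rw [lqDist_planeSite hn hq hq', lqDist_planeSite hn hq hq']
  refine Real.rpow_lt_rpow (by positivity) ?_ (by positivity)
  have : (a : ℝ) ^ q.toReal < ((a + 1 : ℕ) : ℝ) ^ q.toReal :=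
    Real.rpow_lt_rpow (by positivity) (by push_cast; linarith) hp
  linarith

theorem lqDist_lt_up {n : ℕ} (hn : 2 ≤ n) {q : ℝ≥0∞} (hq : 1 ≤ q) (hq' : q ≠ ∞) (a b : ℕ) :
    lqDist q 0 (planeSite n a b) < lqDist q 0 (planeSite n a (b + 1)) := by
  have hp : 0 < q.toReal := ENNReal.toReal_pos (by positivity) hq'
  rw [lqDist_planeSite hn hq hq', lqDist_planeSite hn hq hq']
  refine Real.rpow_lt_rpow (by positivity) ?_ (by positivity)
  have : (b : ℝ) ^ q.toReal < ((b + 1 : ℕ) : ℝ) ^ q.toReal :=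
    Real.rpow_lt_rpow (by positivity) (by push_cast; linarith) hp
  linarith

theorem lqDist_le_up {n : ℕ} (hn : 2 ≤ n) {q : ℝ≥0∞} (hq : 1 ≤ q) (a b : ℕ) :
    lqDist q 0 (planeSite n a b) ≤ lqDist q 0 (planeSite n a (b + 1)) := by
  by_cases hq' : q = ∞
  · subst hq'
    rw [lqDist_top_planeSite hn, lqDist_top_planeSite hn]
    exact max_le_max le_rfl (by push_cast; linarith)
  · exact (lqDist_lt_up hn hq hq' a b).le

/-- With `τ = (y / s) ^ p ≤ κ ^ (-p)`, the right side, the derivative of the `ℓ^p` norm in `s`,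
equals `(1 + τ) ^ (1 / p - 1) ≥ (1 + τ)⁻¹ ≥ 1 - τ`. -/
theorem deriv_lpNorm_ge {p κ s y : ℝ} (hp : 1 ≤ p) (hκ : 0 < κ) (hs : 0 < s) (hy : 0 ≤ y)
    (h : κ * y ≤ s) :
    1 - κ ^ (-p) ≤ (p * s ^ (p - 1)) * (1 / p) * (s ^ p + y ^ p) ^ (1 / p - 1) := by
  have hp0 : 0 < p := by linarith
  set τ := (y / s) ^ p with hτ
  have hτ0 : 0 ≤ τ := by positivity
  have hτ1 : τ ≤ κ ^ (-p) := by
    rw [Real.rpow_neg hκ.le, ← Real.inv_rpow hκ.le]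
    refine Real.rpow_le_rpow (by positivity) ?_ hp0.le
    rw [div_le_iff₀ hs, inv_mul_eq_div, le_div_iff₀ hκ]
    linarith
  have h1 : s ^ p + y ^ p = s ^ p * (1 + τ) := by
    rw [hτ, Real.div_rpow hy hs.le]
    have : s ^ p ≠ 0 := by positivity
    field_simp
  have h2 : (s ^ p) ^ (1 / p - 1) = s ^ (1 - p) := by
    rw [← Real.rpow_mul hs.le]
    congr 1
    field_simp
  have h3 : s ^ (p - 1) * s ^ (1 - p) = 1 := by
    rw [← Real.rpow_add hs]; simp
  have h4 : (p * s ^ (p - 1)) * (1 / p) * (s ^ p + y ^ p) ^ (1 / p - 1) =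
      (1 + τ) ^ (1 / p - 1) := by
    rw [h1, Real.mul_rpow (by positivity) (by positivity), h2]
    calc _ = (p * (1 / p)) * (s ^ (p - 1) * s ^ (1 - p)) * (1 + τ) ^ (1 / p - 1) := by ring
      _ = _ := by rw [h3, mul_one_div_cancel hp0.ne']; ring
  have h5 : (1 + τ) ^ (-1 : ℝ) ≤ (1 + τ) ^ (1 / p - 1) := by
    refine Real.rpow_le_rpow_of_exponent_le (by linarith) ?_
    have : 0 < 1 / p := by positivity
    linarith
  have h6 : 1 - τ ≤ (1 + τ) ^ (-1 : ℝ) := by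
    rw [Real.rpow_neg_one, ← one_div, le_div_iff₀ (by linarith)]
    nlinarith
  rw [h4]
  linarith

theorem lpNorm_increment_ge {p κ x y : ℝ} (hp : 1 ≤ p) (hκ : 0 < κ) (hx : 0 ≤ x) (hy : 0 ≤ y)
    (h : κ * y ≤ x) :
    1 - κ ^ (-p) ≤ ((x + 1) ^ p + y ^ p) ^ (1 / p) - (x ^ p + y ^ p) ^ (1 / p) := by
  have hp0 : 0 < p := by linarith
  obtain ⟨s, hs, hs'⟩ := exists_hasDerivAt_eq_slope (fun s : ℝ => (s ^ p + y ^ p) ^ (1 / p))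
    (fun s => (p * s ^ (p - 1)) * (1 / p) * (s ^ p + y ^ p) ^ (1 / p - 1)) (lt_add_one x)
    (by
      refine ContinuousOn.rpow_const (ContinuousOn.add (ContinuousOn.rpow_const continuousOn_id
        fun _ _ => Or.inr hp0.le) continuousOn_const) fun _ _ => Or.inr (by positivity))
    (fun s hs => by
      have hs0 : 0 < s := hx.trans_lt hs.1
      have h1 : HasDerivAt (fun s : ℝ => s ^ p + y ^ p) (p * s ^ (p - 1)) s :=
        (Real.hasDerivAt_rpow_const (Or.inl hs0.ne')).add_const _
      exact h1.rpow_const (Or.inl (by positivity)))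
  have := deriv_lpNorm_ge hp hκ (hx.trans_lt hs.1) hy (h.trans hs.1.le)
  rw [hs'] at this
  simpa using this

/-- Near the first axis, a step in its direction increases the distance by almost one. -/
theorem exists_increment_bound {n : ℕ} (hn : 2 ≤ n) {q : ℝ≥0∞} (hq : 1 ≤ q) {η : ℝ} (hη : 0 < η) :
    ∃ K₀ : ℕ, ∀ K : ℕ, K₀ ≤ K → ∃ ε : ℝ, 0 ≤ ε ∧ ε < η / K ∧ ∀ a b : ℕ, K * b ≤ a →
      1 - ε ≤ lqDist q 0 (planeSite n (a + 1) b) - lqDist q 0 (planeSite n a b) := by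
  rcases eq_or_ne q ∞ with rfl | hq'
  · refine ⟨1, fun K hK => ⟨0, le_rfl, ?_, fun a b hab => ?_⟩⟩
    · have : (0 : ℝ) < K := by exact_mod_cast hK
      positivity
    · have hb : (b : ℝ) ≤ a := by
        have : b ≤ a := (Nat.le_mul_of_pos_left b hK).trans hab
        exact_mod_cast this
      rw [lqDist_top_planeSite hn, lqDist_top_planeSite hn, max_eq_left hb,
        max_eq_left (by push_cast; linarith)]
      push_cast
      linarith
  -- For `q = 1` the bound `K ^ (-q)` is not `o(1 / K)`, but the increment is exactly 1.
  rcases hq.eq_or_lt with rfl | hq1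
  · refine ⟨1, fun K hK => ⟨0, le_rfl, ?_, fun a b hab => ?_⟩⟩
    · have : (0 : ℝ) < K := by exact_mod_cast hK
      positivity
    · rw [lqDist_one_planeSite hn, lqDist_one_planeSite hn]
      push_cast
      linarith
  · have hp : 1 < q.toReal := by
      rw [← ENNReal.toReal_one]
      exact (ENNReal.toReal_lt_toReal (by simp) hq').2 hq1
    set p := q.toReal with hp_def
    have hlim := (tendsto_rpow_neg_atTop (y := p - 1) (by linarith)).comp
      (tendsto_natCast_atTop_atTop (R := ℝ))
    obtain ⟨K₀, hK₀⟩ := Filter.eventually_atTop.1 (hlim.eventually (gt_mem_nhds hη))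
    refine ⟨max K₀ 1, fun K hK => ⟨(K : ℝ) ^ (-p), by positivity, ?_, fun a b hab => ?_⟩⟩
    · have hK0 : (0 : ℝ) < K := by
        have : 0 < K := (le_max_right _ _).trans hK
        exact_mod_cast this
      have h1 : (K : ℝ) ^ (-(p - 1)) < η := hK₀ K ((le_max_left _ _).trans hK)
      rw [lt_div_iff₀ hK0]
      refine lt_of_eq_of_lt ?_ h1
      conv_lhs => rw [← Real.rpow_one (K : ℝ), ← Real.rpow_mul hK0.le, ← Real.rpow_add hK0]
      congr 1
      ring
    · have hK0 : (0 : ℝ) < K := by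
        have : 0 < K := (le_max_right _ _).trans hK
        exact_mod_cast this
      rw [lqDist_planeSite hn hq hq', lqDist_planeSite hn hq hq']
      push_cast
      exact lpNorm_increment_ge hp.le hK0 (by positivity) (by positivity) (by exact_mod_cast hab)

/-! ### Percolation along a surface of good cells -/

theorem label_lt_right {n : ℕ} {q : ℝ≥0∞} {θ δ ε : ℝ} {U : Site n → ℝ} {v v' : Site n} (hθ : 0 ≤ θ)
    (hε : 1 - 2 * δ ≤ θ * (1 - ε)) (hv : U v ∈ Ioo δ (1 - δ)) (hv' : U v' ∈ Ioo δ (1 - δ))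
    (hd : 1 - ε ≤ lqDist q 0 v' - lqDist q 0 v) : label q θ U v < label q θ U v' := by
  have := mul_le_mul_of_nonneg_left hd hθ
  unfold label
  linarith [hv.2, hv'.1]

/-- An accessible path of unit steps to the right and upwards in the first coordinate plane. -/
theorem exists_plane_path {n : ℕ} (hn : 2 ≤ n) {q : ℝ≥0∞} (hq : 1 ≤ q) {K : ℕ} (hK : 0 < K)
    {θ δ ε : ℝ} {U : Site n → ℝ} (hθ : 0 ≤ θ) (hε : 1 - 2 * δ ≤ θ * (1 - ε))
    (hd : ∀ a b : ℕ, K * b ≤ a →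
      1 - ε ≤ lqDist q 0 (planeSite n (a + 1) b) - lqDist q 0 (planeSite n a b))
    (hU : ¬ Blocked (BadCell n K δ U) 1 1) :
    ∃ p : ℕ → ℕ × ℕ, p 0 = (0, 0) ∧ ∀ k,
      (p (k + 1) = ((p k).1 + 1, (p k).2) ∨ p (k + 1) = ((p k).1, (p k).2 + 1)) ∧
      label q θ U (planeSite n (p k).1 (p k).2) <
        label q θ U (planeSite n (p (k + 1)).1 (p (k + 1)).2) := by
  obtain ⟨F, hF0, hF1, hgood, hF⟩ := exists_surface hU
  simp only [BadCell, badPattern, mem_ofPred_eq, not_not] at hgood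
  choose hIoo s hs hs' using hgood
  -- Since `F 1 = 0`, the row in block `i` is at most `i` even after its step up, which keeps the
  -- path in the cone `K * b ≤ a`.
  have hle : ∀ i, F (i + 1) ≤ i := by
    intro i
    induction i with
    | zero => exact hF1.le
    | succ i ih => exact (hF (i + 1)).2.trans (by omega)
  -- The staircase: in block `i`, row `F i` up to the crossing column `s i` (all the way if `F` is
  -- flat there), and row `F (i + 1)` from that column on.
  let S : ℕ × ℕ → Prop := fun v => ∃ i c, c < K ∧ v.1 = i * K + c ∧
    ((v.2 = F i ∧ (F (i + 1) = F i ∨ c ≤ s i)) ∨ (v.2 = F (i + 1) ∧ (s i : ℕ) ≤ c))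
  have hS_Ioo : ∀ v, S v → U (planeSite n v.1 v.2) ∈ Ioo δ (1 - δ) := by
    rintro ⟨a, b⟩ ⟨i, c, hc, ha, hb⟩
    simp only at ha hb
    have h2 : b = F i ∨ b = F i + 1 := by
      have := hF i
      omega
    rcases h2 with h2 | h2
    · simpa [cellSite, ha, h2] using hIoo i (⟨c, hc⟩, false)
    · simpa [cellSite, ha, h2] using hIoo i (⟨c, hc⟩, true)
  have hS_cone : ∀ v, S v → K * v.2 ≤ v.1 := by
    rintro ⟨a, b⟩ ⟨i, c, hc, ha, hb⟩
    simp only at ha hb ⊢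
    have h2 : b ≤ i := by
      have := hF i
      have := hle i
      omega
    calc K * b ≤ K * i := Nat.mul_le_mul_left _ h2
      _ ≤ a := by rw [ha, mul_comm]; omega
  have hright : ∀ v, S v → S (v.1 + 1, v.2) → label q θ U (planeSite n v.1 v.2) <
      label q θ U (planeSite n (v.1 + 1) v.2) := fun v h h' =>
    label_lt_right hθ hε (hS_Ioo _ h) (hS_Ioo _ h') (hd _ _ (hS_cone _ h))
  have hstep : ∀ v, S v → ∃ v', S v' ∧ (v' = (v.1 + 1, v.2) ∨ v' = (v.1, v.2 + 1)) ∧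
      label q θ U (planeSite n v.1 v.2) < label q θ U (planeSite n v'.1 v'.2) := by
    intro v hv
    suffices h : S (v.1 + 1, v.2) ∨ S (v.1, v.2 + 1) ∧
        label q θ U (planeSite n v.1 v.2) < label q θ U (planeSite n v.1 (v.2 + 1)) by
      rcases h with h | h
      · exact ⟨_, h, Or.inl rfl, hright v hv h⟩
      · exact ⟨_, h.1, Or.inr rfl, h.2⟩
    obtain ⟨i, c, hc, ha, hb⟩ := hv
    have hs_lt : (s i : ℕ) < K := (s i).2
    have next : c + 1 = K → v.2 = F (i + 1) → S (v.1 + 1, v.2) := fun hcK hb' =>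
      ⟨i + 1, 0, hK, by simp only [add_zero, Nat.add_mul, one_mul]; omega,
        Or.inl ⟨hb', Or.inr (Nat.zero_le _)⟩⟩
    rcases hb with ⟨hb, hflat | hcs⟩ | ⟨hb, hcs⟩
    · left
      rcases Nat.lt_or_ge (c + 1) K with h | h
      · exact ⟨i, c + 1, h, by simp only; omega, Or.inl ⟨hb, Or.inl hflat⟩⟩
      · exact next (by omega) (by omega)
    · rcases hcs.lt_or_eq with h | h
      · exact Or.inl ⟨i, c + 1, by omega, by simp only; omega, Or.inl ⟨hb, Or.inr h⟩⟩
      · rcases Nat.lt_or_ge (F i) (F (i + 1)) with hlt | hge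
        · right
          refine ⟨⟨i, c, hc, ha, Or.inr ⟨?_, h.ge⟩⟩, ?_⟩
          · have := (hF i).2
            simp only
            omega
          -- In the crossing column the noise rises through `1/2`, while the distance does not
          -- decrease.
          · have h1 := hs i
            have h2 := hs' i
            have h3 := mul_le_mul_of_nonneg_left (lqDist_le_up hn hq v.1 v.2) hθ
            simp only [cellSite, Bool.toNat_false, Bool.toNat_true, add_zero, ← h, ← ha,
              ← hb] at h1 h2
            unfold label
            linarith
        · left
          have hflat : F (i + 1) = F i := le_antisymm hge (hF i).1
          rcases Nat.lt_or_ge (c + 1) K with h | h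
          · exact ⟨i, c + 1, h, by simp only; omega, Or.inl ⟨hb, Or.inl hflat⟩⟩
          · exact next (by omega) (by omega)
    · left
      rcases Nat.lt_or_ge (c + 1) K with h | h
      · exact ⟨i, c + 1, h, by simp only; omega, Or.inr ⟨hb, by omega⟩⟩
      · exact next (by omega) hb
  choose! f hfS hf using hstep
  have hS0 : S (0, 0) := ⟨0, 0, hK, by simp, Or.inl ⟨hF0.symm, Or.inr (Nat.zero_le _)⟩⟩
  have hSk : ∀ k, S (f^[k] (0, 0)) := by
    intro k
    induction k with
    | zero => exact hS0
    | succ k ih => rw [Function.iterate_succ_apply']; exact hfS _ ih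
  refine ⟨fun k => f^[k] (0, 0), rfl, fun k => ?_⟩
  simp only [Function.iterate_succ_apply']
  exact hf _ (hSk k)

theorem latticeGraph_adj_right {n : ℕ} (hn : 2 ≤ n) (a b : ℕ) :
    (latticeGraph n).Adj (planeSite n a b) (planeSite n (a + 1) b) := by
  obtain ⟨m, rfl⟩ := Nat.exists_eq_add_of_le' hn
  change ∑ i, |planeSite (m + 2) a b i - planeSite (m + 2) (a + 1) b i| = 1
  rw [Fin.sum_univ_succ, Fin.sum_univ_succ]
  simp [planeSite]

theorem latticeGraph_adj_up {n : ℕ} (hn : 2 ≤ n) (a b : ℕ) :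
    (latticeGraph n).Adj (planeSite n a b) (planeSite n a (b + 1)) := by
  obtain ⟨m, rfl⟩ := Nat.exists_eq_add_of_le' hn
  change ∑ i, |planeSite (m + 2) a b i - planeSite (m + 2) a (b + 1) i| = 1
  rw [Fin.sum_univ_succ, Fin.sum_univ_succ]
  simp [planeSite]

theorem exists_accessible_path {n : ℕ} (hn : 2 ≤ n) {q : ℝ≥0∞} (hq : 1 ≤ q) {K : ℕ} (hK : 0 < K)
    {θ δ ε : ℝ} {U : Site n → ℝ} (hθ : 0 ≤ θ) (hε : 1 - 2 * δ ≤ θ * (1 - ε))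
    (hd : ∀ a b : ℕ, K * b ≤ a →
      1 - ε ≤ lqDist q 0 (planeSite n (a + 1) b) - lqDist q 0 (planeSite n a b))
    (hU : ¬ Blocked (BadCell n K δ U) 1 1) :
    ∃ x : ℕ → Site n, IsInfinitePath x ∧ (∀ r, 1 ≤ r → r ≠ ∞ → MovesAway r x) ∧
      ∀ j, label q θ U (x j) < label q θ U (x (j + 1)) := by
  obtain ⟨p, hp0, hp⟩ := exists_plane_path hn hq hK hθ hε hd hU
  -- The coordinate sum is the time, which makes the path simple.
  have hsum : ∀ k, (p k).1 + (p k).2 = k := by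
    intro k
    induction k with
    | zero => simp [hp0]
    | succ k ih => rcases (hp k).1 with h | h <;> rw [h] <;> simp only <;> omega
  refine ⟨fun k => planeSite n (p k).1 (p k).2, ⟨?_, fun k => ?_, fun k l hkl => ?_⟩,
    fun r hr hr' k => ?_, fun k => (hp k).2⟩
  · funext i
    simp [planeSite, hp0]
  · rcases (hp k).1 with h | h <;> simp only [h]
    · exact latticeGraph_adj_right hn _ _
    · exact latticeGraph_adj_up hn _ _
  · obtain ⟨h1, h2⟩ := planeSite_inj hn hkl
    rw [← hsum k, ← hsum l, h1, h2]
  · rcases (hp k).1 with h | h <;> simp only [h]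
    · exact lqDist_lt_right hn hr hr' _ _
    · exact lqDist_lt_up hn hr hr' _ _

/-- Percolation along paths that move away from the origin in all `ℓ^r` distances with `r < ∞`
occurs for some `θ < 1`. -/
theorem exists_noise_percolates_pos {n : ℕ} (hn : 2 ≤ n) {q : ℝ≥0∞} (hq : 1 ≤ q) :
    ∃ θ : ℝ, 0 ≤ θ ∧ θ < 1 ∧ ∀ allowed : (ℕ → Site n) → Prop,
      (∀ x, (∀ r, 1 ≤ r → r ≠ ∞ → MovesAway r x) → allowed x) →
      0 < noise n {U | Percolates q allowed θ U} := by
  obtain ⟨η, hη, K₁, hK₁⟩ := exists_noise_blocked_le hn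
  obtain ⟨K₂, hK₂⟩ := exists_increment_bound hn hq hη
  obtain ⟨K₃, hK₃⟩ := exists_nat_gt η
  set K := max (max K₁ K₂) K₃ with hKdef
  have hK : η < K := hK₃.trans_le (by exact_mod_cast le_max_right _ _)
  have hK0 : (0 : ℝ) < K := hη.trans hK
  obtain ⟨ε, hε0, hε, hd⟩ := hK₂ K ((le_max_right _ _).trans (le_max_left _ _))
  have hB := hK₁ K ((le_max_left _ _).trans (le_max_left _ _))
  set δ := η / K with hδ
  have hδ1 : δ < 1 := (div_lt_one hK0).2 hK
  have hε1 : 0 < 1 - ε := by linarith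
  refine ⟨max 0 ((1 - 2 * δ) / (1 - ε)), le_max_left _ _, max_lt one_pos ?_,
    fun allowed hall => ?_⟩
  · rw [div_lt_one hε1]
    linarith
  · have hθ : 1 - 2 * δ ≤ max 0 ((1 - 2 * δ) / (1 - ε)) * (1 - ε) :=
      (div_le_iff₀ hε1).1 (le_max_right _ _)
    -- If percolation were null, the bound `1/2` for blocking would contradict total mass 1. Only
    -- subadditivity is used, so measurability of these events is not needed.
    by_contra hzero
    have hzero := le_antisymm (not_lt.1 hzero) zero_le
    have huniv : (univ : Set (Site n → ℝ)) ⊆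
        {U | Percolates q allowed (max 0 ((1 - 2 * δ) / (1 - ε))) U} ∪
          {U | Blocked (BadCell n K δ U) 1 1} := by
      intro U _
      by_cases hU : Blocked (BadCell n K δ U) 1 1
      · exact Or.inr hU
      · obtain ⟨x, hx, hx', hlab⟩ := exists_accessible_path hn hq (by exact_mod_cast hK0)
          (le_max_left _ _) hθ hd hU
        exact Or.inl ⟨x, hx, hall x hx', hlab⟩
    have h1 : (1 : ℝ≥0∞) ≤ 0 + 2⁻¹ := by
      calc (1 : ℝ≥0∞) = noise n univ := measure_univ.symm
        _ ≤ _ := (measure_mono huniv).trans (measure_union_le _ _)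
        _ ≤ 0 + 2⁻¹ := add_le_add hzero.le hB
    norm_num at h1

end RMF

theorem theorem1p3 (n : ℕ) (hn : 2 ≤ n) (q : ℝ≥0∞) (hq : 1 ≤ q) :
    (q ≠ ∞ → RMF.thetaC (n := n) q (RMF.MovesAway q) ∈ Set.Ioo (0 : ℝ) 1) ∧
      RMF.thetaC (n := n) q (RMF.MovesAway 1) ∈ Set.Ioo (0 : ℝ) 1 ∧
      RMF.thetaC (n := n) q (fun _ => True) ∈ Set.Ioo (0 : ℝ) 1 := by
  obtain ⟨θ, h0, h1, h⟩ := RMF.exists_noise_percolates_pos hn hq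
  exact ⟨fun hq' => RMF.thetaC_mem_Ioo hq h0 h1 (h _ fun x hx => hx q hq hq'),
    RMF.thetaC_mem_Ioo hq h0 h1 (h _ fun x hx => hx 1 le_rfl (by simp)),
    RMF.thetaC_mem_Ioo hq h0 h1 (h _ fun x hx => trivial)⟩
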